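/- Conventions. For a square matrix $A$ over a field $\mathbb F$ and an integer $r\ge 0$, $\mathcal R_A(r)$ is the minimum number of nonzero entries of a matrix $B$ over $\mathbb F$ with $\operatorname{rank}(A+B)\le r$, and $\mathcal R^{rc}_A(r)$ is the minimum, over the same matrices $B$, of the maximum number of nonzero entries in a row or a column of $B$; for real $r\ge 0$ read $\mathcal R_A(\lfloor r\rfloor)$ and $\mathcal R^{rc}_A(\lfloor r\rfloor)$. A family $(A_k)$ of matrices $A_k\in\mathbb F^{N_k\times N_k}$ is Valiant-rigid if there are fixed $\varepsilon>0$ and $C>0$ with $\mathcal R_{A_k}(C N_k/\log\log N_k)\ge N_k^{1+\varepsilon}$ for infinitely many $k$. Logarithms are natural. Theorem. (1) There are absolute constants $c>0$, $\varepsilon_0\in(0,1)$ and $K>0$ such that for every field $\mathbb F$, every integer $q\ge 2$, every $\varepsilon\in(0,\varepsilon_0)$, every integer $n\ge K\,\bigl(q\log(1/\varepsilon)/\varepsilon\bigr)^2$ and all matrices $M_1,\dots,M_n\in\mathbb F^{q\times q}$, the Kronecker product $M=\bigotimes_{\ell=1}^n M_\ell\in\mathbb F^{N\times N}$, $N=q^n$,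 satisfies $$\mathcal R^{rc}_M\Bigl(N^{\,1-c\cdot 2^{-q}\,q\log q\cdot \varepsilon^2/\log^2(1/\varepsilon)}\Bigr)\le N^{\varepsilon}.$$ (2) Such products with $q\le O(\log n)$ are not Valiant-rigid: for every field $\mathbb F$, all sequences of integers $q_k\ge 2$ and $n_k\to\infty$ with $q_k=O(\log n_k)$, and all matrices $M_{k,1},\dots,M_{k,n_k}\in\mathbb F^{q_k\times q_k}$, the family $\bigl(\bigotimes_{\ell=1}^{n_k}M_{k,\ell}\bigr)_k$ is not Valiant-rigid. -/

import Mathlib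

open Filter Asymptotics

noncomputable section

namespace KroneckerRigidity

open Classical in
/-- Sparsity: the number of nonzero entries of a matrix. -/
def nnz {m n F : Type*} [Fintype m] [Fintype n] [Zero F] (A : Matrix m n F) : ℕ :=
  (Finset.univ.filter fun p : m × n => A p.1 p.2 ≠ 0).card

open Classical in
/-- Row sparsity: the maximum number of nonzero entries in a row. -/
def nnzRow {m n F : Type*} [Fintype m] [Fintype n] [Zero F] (A : Matrix m n F) : ℕ :=
  Finset.univ.sup fun i : m => (Finset.univ.filter fun j : n => A i j ≠ 0).card

open Classical in
/-- Column sparsity: the maximum number of nonzero entries in a column. -/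
def nnzCol {m n F : Type*} [Fintype m] [Fintype n] [Zero F] (A : Matrix m n F) : ℕ :=
  Finset.univ.sup fun j : n => (Finset.univ.filter fun i : m => A i j ≠ 0).card

/-- The rank-`r` rigidity of `A`: the least number of entries that have to be changed in order
to bring the rank down to at most `r`. The set is nonempty (take `B = -A`), so this infimum of
natural numbers is a minimum. -/
def rigidity {m F : Type*} [Fintype m] [Field F] (A : Matrix m m F) (r : ℕ) : ℕ :=
  sInf {s : ℕ | ∃ B : Matrix m m F, (A + B).rank ≤ r ∧ nnz B = s}

/-- The rank-`r` row/column rigidity of `A`: the least number of entries that have to be changed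
per row or column in order to bring the rank down to at most `r`. -/
def rcRigidity {m F : Type*} [Fintype m] [Field F] (A : Matrix m m F) (r : ℕ) : ℕ :=
  sInf {s : ℕ | ∃ B : Matrix m m F, (A + B).rank ≤ r ∧ max (nnzRow B) (nnzCol B) = s}

/-- The Kronecker product of `n` matrices of size `q × q`. Its rows and columns are indexed by
the `q ^ n` tuples in `{0, …, q - 1} ^ n`. -/
def kron {F : Type*} [Field F] {n q : ℕ} (M : Fin n → Matrix (Fin q) (Fin q) F) :
    Matrix (Fin n → Fin q) (Fin n → Fin q) F :=
  Matrix.of fun x y => ∏ l, M l (x l) (y l)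

/-- A family of square matrices `A k` of sizes `N k` over `F` is Valiant-rigid if for some fixed
`ε > 0` the rank-`O(N / log log N)` rigidity is at least `N ^ (1 + ε)`. This is the most inclusive
reading (some constant in the `O`, infinitely many members of the family), so that failing to be
Valiant-rigid is the strongest assertion: for all `ε, C > 0`, all but finitely many members have
rank-`C N / log log N` rigidity below `N ^ (1 + ε)`. -/
def IsValiantRigid {F : Type*} [Field F] {ι : ℕ → Type*} [∀ k, Fintype (ι k)]
    (A : ∀ k, Matrix (ι k) (ι k) F) : Prop :=
  ∃ ε : ℝ, 0 < ε ∧ ∃ C : ℝ, 0 < C ∧ ∃ᶠ k in atTop,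
    (Fintype.card (ι k) : ℝ) ^ (1 + ε) ≤
      (rigidity (A k)
        ⌊C * (Fintype.card (ι k) : ℝ) / Real.log (Real.log (Fintype.card (ι k) : ℝ))⌋₊ : ℝ)

end KroneckerRigidity

end

/-! Factor each `M l` as `L l * U l`, with `L l` a row permutation of a lower triangular matrix and
`U l` upper triangular; then `kron M = kron L * kron U`. A nonzero entry of `kron L` at `(x, y)`
forces `y ≤ σ x` in every coordinate. Coordinate sums concentrate around their mean, so by Hoeffding
few rows have `σ x` much heavier than average and few columns have `y` much lighter; clearing them
costs little rank. In what remains, `σ x - y` is a nonnegative tuple of sum at most `η n`, and such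
tuples are few, so rows and columns are sparse (`isLowRankAddSparse_kron_of_triangular`). Sums of a
low-rank and a row/column-sparse matrix are closed under products (`IsLowRankAddSparse.mul`), which
gives the bound for `kron M` with a free parameter `η`. Both claims are choices of `η`. -/

namespace KroneckerRigidity

/-! ### Triangular factorization up to a row permutation -/

section LU

variable {F : Type*} [Field F]

/-- Every square matrix over a field is a row permutation of a lower triangular matrix times an
upper triangular matrix. -/
theorem exists_perm_triangular_mul_triangular :
    ∀ (q : ℕ) (A : Matrix (Fin q) (Fin q) F),
      ∃ (σ : Equiv.Perm (Fin q)) (L U : Matrix (Fin q) (Fin q) F),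
        (∀ i k, L i k ≠ 0 → k ≤ σ i) ∧ (∀ k j, U k j ≠ 0 → k ≤ j) ∧ A = L * U
  | 0, A => ⟨1, 0, 0, by simp, by simp, by ext i; exact i.elim0⟩
  | q + 1, A => by
    -- A zero pivot is allowed only if the whole column vanishes; the multipliers `A i 0 / A p 0`
    -- are then `0` and elimination still works.
    obtain ⟨p, hp⟩ : ∃ p, A p 0 = 0 → ∀ i, A i 0 = 0 := by
      by_cases h : ∃ p, A p 0 ≠ 0
      · exact ⟨h.choose, fun h0 => absurd h0 h.choose_spec⟩
      · push Not at h
        exact ⟨0, fun _ => h⟩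
    -- Recursion on the Schur complement of the pivot; the new permutation sends `p` to `0` and
    -- follows `σ` elsewhere.
    obtain ⟨σ, L, U, hL, hU, hS⟩ := exists_perm_triangular_mul_triangular q
      (Matrix.of fun i j => A (p.succAbove i) (Fin.succ j)
        - A (p.succAbove i) 0 / A p 0 * A p (Fin.succ j))
    refine ⟨(finSuccEquiv' p).trans ((Equiv.optionCongr σ).trans (finSuccEquiv' 0).symm),
      Matrix.of (Fin.insertNth (α := fun _ => Fin (q + 1) → F) p (Fin.cons 1 0)
        fun i => Fin.cons (A (p.succAbove i) 0 / A p 0) (L i)),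
      Matrix.of (Fin.cons (A p) fun k => Fin.cons 0 (U k)), ?_, ?_, ?_⟩
    · intro i k
      induction i using Fin.succAboveCases p with
      | x => cases k using Fin.cases <;> simp
      | p i =>
        cases k using Fin.cases with
        | zero => simp
        | succ k => simpa using hL i k
    · intro k j
      cases k using Fin.cases with
      | zero => simp
      | succ k =>
        cases j using Fin.cases with
        | zero => simp
        | succ j => simpa using hU k j
    · ext i j
      rw [Matrix.mul_apply, Fin.sum_univ_succ]
      induction i using Fin.succAboveCases p with
      | x => simp
      | p i =>
        cases j using Fin.cases with
        | zero =>
          by_cases h : A p 0 = 0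
          · simp [h, hp h]
          · simp [h]
        | succ j =>
          have := congrFun (congrFun hS i) j
          rw [Matrix.mul_apply] at this
          simp only [Matrix.of_apply] at this
          simp [← this]

end LU

/-! ### Tail bounds for coordinate sums -/

section Counting

/-- Moment generating function of the uniform distribution on `{0, …, q - 1}`. -/
theorem sum_exp_centered_le (q : ℕ) (t : ℝ) :
    ∑ i : Fin q, Real.exp (t * ((i : ℕ) - ((q : ℝ) - 1) / 2)) ≤
      q * Real.exp (t ^ 2 * ((q : ℝ) - 1) ^ 2 / 8) := by
  -- The reflection `i ↦ q - 1 - i` symmetrizes the sum into one of `cosh`, and `cosh x ≤ exp (x² /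
  -- 2)`.
  have h1 : ∑ i : Fin q, Real.exp (t * ((i : ℕ) - ((q : ℝ) - 1) / 2)) =
      ∑ i : Fin q, Real.exp (-(t * ((i : ℕ) - ((q : ℝ) - 1) / 2))) := by
    rw [← Equiv.sum_comp Fin.revPerm]
    refine Finset.sum_congr rfl fun i _ => ?_
    have : (((Fin.rev i : Fin q) : ℕ) : ℝ) = q - 1 - (i : ℕ) := by
      rw [Fin.val_rev, Nat.cast_sub (by omega)]
      push_cast
      ring
    rw [Fin.revPerm_apply, this]
    congr 1
    ring
  have h2 : ∑ i : Fin q, Real.exp (t * ((i : ℕ) - ((q : ℝ) - 1) / 2)) =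
      ∑ i : Fin q, Real.cosh (t * ((i : ℕ) - ((q : ℝ) - 1) / 2)) := by
    simp only [Real.cosh_eq]
    rw [← Finset.sum_div, Finset.sum_add_distrib, ← h1]
    ring
  rw [h2]
  refine (Finset.sum_le_card_nsmul _ _ (Real.exp (t ^ 2 * ((q : ℝ) - 1) ^ 2 / 8)) ?_).trans
    (by simp)
  intro i _
  refine (Real.cosh_le_exp_half_sq _).trans (Real.exp_le_exp.2 ?_)
  have hi : ((i : ℕ) : ℝ) + 1 ≤ q := by exact_mod_cast i.2
  have hi0 : (0 : ℝ) ≤ (i : ℕ) := by positivity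
  have : ((i : ℕ) - ((q : ℝ) - 1) / 2) ^ 2 ≤ ((q : ℝ) - 1) ^ 2 / 4 := by nlinarith
  nlinarith [mul_le_mul_of_nonneg_left this (sq_nonneg t)]

variable {n q : ℕ}

/-- The coordinate sum of a tuple. -/
def weight (x : Fin n → Fin q) : ℝ := ∑ l, ((x l : ℕ) : ℝ)

/-- Coordinates are independent, and a permutation only reorders the sum in its own coordinate. -/
theorem sum_exp_mul_weight (σ : Fin n → Equiv.Perm (Fin q)) (t a : ℝ) :
    ∑ x : Fin n → Fin q, Real.exp (t * (weight (fun l => σ l (x l)) - n * a)) =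
      (∑ i : Fin q, Real.exp (t * ((i : ℕ) - a))) ^ n := by
  have h (l : Fin n) : ∑ i : Fin q, Real.exp (t * ((i : ℕ) - a)) =
      ∑ i : Fin q, Real.exp (t * ((σ l i : ℕ) - a)) :=
    (Equiv.sum_comp (σ l) fun i : Fin q => Real.exp (t * ((i : ℕ) - a))).symm
  calc _ = ∑ x : Fin n → Fin q, ∏ l, Real.exp (t * ((σ l (x l) : ℕ) - a)) := by
        refine Finset.sum_congr rfl fun x _ => ?_
        rw [← Real.exp_sum, ← Finset.mul_sum, Finset.sum_sub_distrib, weight]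
        simp
    _ = ∏ l : Fin n, ∑ i : Fin q, Real.exp (t * ((σ l i : ℕ) - a)) := by
        rw [Finset.prod_univ_sum, Fintype.piFinset_univ]
    _ = _ := by simp [← h]

open Classical in
/-- Hoeffding's inequality for the coordinate sum of a uniformly random tuple. -/
theorem card_weight_gt_le (hq : 0 < q) (σ : Fin n → Equiv.Perm (Fin q)) {η : ℝ} (hη : 0 ≤ η) :
    ((Finset.univ.filter fun x : Fin n → Fin q =>
        n * (((q : ℝ) - 1) / 2) + η * n / 2 < weight fun l => σ l (x l)).card : ℝ) ≤
      (q : ℝ) ^ n * Real.exp (-(η ^ 2 * n / (2 * (q : ℝ) ^ 2))) := by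
  have hq' : (1 : ℝ) ≤ q := by exact_mod_cast hq
  -- Minimizer of `n t² q² / 8 - t η n / 2`, the Chernoff exponent with `q - 1` relaxed to `q`.
  set t : ℝ := 2 * η / (q : ℝ) ^ 2 with ht
  set X := Finset.univ.filter fun x : Fin n → Fin q =>
        n * (((q : ℝ) - 1) / 2) + η * n / 2 < weight fun l => σ l (x l) with hX
  clear_value X
  have h1 : (X.card : ℝ) * Real.exp (t * (η * n / 2)) ≤
      (q * Real.exp (t ^ 2 * ((q : ℝ) - 1) ^ 2 / 8)) ^ n := by
    calc (X.card : ℝ) * Real.exp (t * (η * n / 2)) = ∑ x ∈ X, Real.exp (t * (η * n / 2)) := by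
          rw [Finset.sum_const, nsmul_eq_mul]
      _ ≤ ∑ x ∈ X, Real.exp (t * (weight (fun l => σ l (x l)) - n * (((q : ℝ) - 1) / 2))) := by
          refine Finset.sum_le_sum fun x hx => Real.exp_le_exp.2 ?_
          rw [hX, Finset.mem_filter] at hx
          refine mul_le_mul_of_nonneg_left (by linarith [hx.2]) (by positivity)
      _ ≤ ∑ x : Fin n → Fin q,
            Real.exp (t * (weight (fun l => σ l (x l)) - n * (((q : ℝ) - 1) / 2))) :=
          Finset.sum_le_sum_of_subset_of_nonneg (Finset.subset_univ _)
            fun _ _ _ => (Real.exp_pos _).le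
      _ ≤ _ := by
          rw [sum_exp_mul_weight]
          exact pow_le_pow_left₀ (Finset.sum_nonneg fun _ _ => (Real.exp_pos _).le)
            (sum_exp_centered_le q t) n
  rw [mul_pow, ← Real.exp_nat_mul] at h1
  have h2 : n * (t ^ 2 * ((q : ℝ) - 1) ^ 2 / 8) ≤
      -(η ^ 2 * n / (2 * (q : ℝ) ^ 2)) + t * (η * n / 2) := by
    have e1 : n * (t ^ 2 * ((q : ℝ) - 1) ^ 2 / 8) ≤ n * (t ^ 2 * (q : ℝ) ^ 2 / 8) := by
      gcongr
      · linarith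
    refine e1.trans (le_of_eq ?_)
    rw [ht]
    field_simp
    ring
  have h3 := h1.trans (mul_le_mul_of_nonneg_left (Real.exp_le_exp.2 h2) (by positivity))
  rw [Real.exp_add, ← mul_assoc] at h3
  exact le_of_mul_le_mul_right h3 (Real.exp_pos _)

open Classical in
-- Chernoff bound with `exp (-t) = η`: each coordinate contributes at most a full geometric series
-- in `η`, so the bound does not depend on `q`.
theorem card_weight_le_le {η : ℝ} (hη : 0 < η) (hη' : η ≤ 1 / 2) :
    ((Finset.univ.filter fun z : Fin n → Fin q => weight z ≤ η * n).card : ℝ) ≤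
      Real.exp (n * (η * Real.log (1 / η) + 2 * η)) := by
  set t : ℝ := Real.log (1 / η) with ht
  have ht0 : 0 ≤ t := Real.log_nonneg (by rw [le_div_iff₀ hη]; linarith)
  have hexp : Real.exp (-t) = η := by
    rw [ht, one_div, Real.log_inv, neg_neg, Real.exp_log hη]
  have hgeom : ∑ i : Fin q, Real.exp (-t * ((i : ℕ) - 0)) ≤ Real.exp (2 * η) := by
    have : ∀ i : Fin q, Real.exp (-t * ((i : ℕ) - 0)) = η ^ (i : ℕ) := fun i => by
      rw [sub_zero, mul_comm, Real.exp_nat_mul, hexp]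
    simp only [this]
    rw [Fin.sum_univ_eq_sum_range fun i => η ^ i]
    calc _ ≤ ∑' i, η ^ i := (summable_geometric_of_lt_one hη.le (by linarith)).sum_le_tsum _
            fun _ _ => by positivity
      _ = (1 - η)⁻¹ := tsum_geometric_of_lt_one hη.le (by linarith)
      _ ≤ 1 + 2 * η := by
          rw [inv_le_iff_one_le_mul₀ (by linarith)]
          nlinarith
      _ ≤ _ := by linarith [Real.add_one_le_exp (2 * η)]
  set Z := Finset.univ.filter fun z : Fin n → Fin q => weight z ≤ η * n with hZ
  have h1 : (Z.card : ℝ) * Real.exp (-t * (η * n)) ≤ Real.exp (2 * η) ^ n := by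
    calc (Z.card : ℝ) * Real.exp (-t * (η * n)) = ∑ z ∈ Z, Real.exp (-t * (η * n)) := by
          rw [Finset.sum_const, nsmul_eq_mul]
      _ ≤ ∑ z ∈ Z, Real.exp (-t * (weight z - n * 0)) := by
          refine Finset.sum_le_sum fun z hz => Real.exp_le_exp.2 ?_
          rw [hZ, Finset.mem_filter] at hz
          nlinarith [hz.2]
      _ ≤ ∑ z, Real.exp (-t * (weight z - n * 0)) :=
          Finset.sum_le_sum_of_subset_of_nonneg (Finset.subset_univ _)
            fun _ _ _ => (Real.exp_pos _).le
      _ ≤ _ := by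
          have := sum_exp_mul_weight (n := n) (q := q) (fun _ => 1) (-t) 0
          simp only [Equiv.Perm.coe_one, id_eq] at this
          rw [this]
          exact pow_le_pow_left₀ (Finset.sum_nonneg fun _ _ => (Real.exp_pos _).le) hgeom n
  rw [← Real.exp_nat_mul] at h1
  have h2 : n * (2 * η) = n * (η * t + 2 * η) + -t * (η * n) := by ring
  rw [h2, Real.exp_add] at h1
  exact le_of_mul_le_mul_right h1 (Real.exp_pos _)

end Counting

/-! ### Low rank plus sparse decompositions -/

section LowRankAddSparse

variable {m F : Type*} [Fintype m] [Field F]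

theorem rank_add_le (A B : Matrix m m F) : (A + B).rank ≤ A.rank + B.rank := by
  rw [Matrix.rank, Matrix.rank, Matrix.rank, Matrix.mulVecLin_add]
  exact (Submodule.finrank_mono (LinearMap.range_add_le _ _)).trans
    (Submodule.finrank_add_le_finrank_add_finrank _ _)

open Classical in
theorem nnzRow_le_iff {S : Matrix m m F} {s : ℕ} :
    nnzRow S ≤ s ↔ ∀ i, (Finset.univ.filter fun j => S i j ≠ 0).card ≤ s := by
  simp [nnzRow, Finset.sup_le_iff]

open Classical in
theorem nnzCol_le_iff {S : Matrix m m F} {s : ℕ} :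
    nnzCol S ≤ s ↔ ∀ j, (Finset.univ.filter fun i => S i j ≠ 0).card ≤ s := by
  simp [nnzCol, Finset.sup_le_iff]

theorem nnzRow_transpose (S : Matrix m m F) : nnzRow S.transpose = nnzCol S := rfl

theorem nnzCol_transpose (S : Matrix m m F) : nnzCol S.transpose = nnzRow S := rfl

open Classical in
theorem nnzRow_neg (S : Matrix m m F) : nnzRow (-S) = nnzRow S :=
  Finset.sup_congr rfl fun _ _ => congrArg Finset.card (Finset.filter_congr fun _ _ => by simp)

open Classical in
theorem nnzCol_neg (S : Matrix m m F) : nnzCol (-S) = nnzCol S :=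
  Finset.sup_congr rfl fun _ _ => congrArg Finset.card (Finset.filter_congr fun _ _ => by simp)

open Classical in
theorem nnz_neg (S : Matrix m m F) : nnz (-S) = nnz S :=
  congrArg Finset.card (Finset.filter_congr fun _ _ => by simp)

theorem nnzRow_mul_le (A B : Matrix m m F) : nnzRow (A * B) ≤ nnzRow A * nnzRow B := by
  classical
  rw [nnzRow_le_iff]
  intro i
  have hsub : (Finset.univ.filter fun j => (A * B) i j ≠ 0) ⊆
      (Finset.univ.filter fun k => A i k ≠ 0).biUnion
        fun k => Finset.univ.filter fun j => B k j ≠ 0 := by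
    intro j hj
    rw [Finset.mem_filter, Matrix.mul_apply] at hj
    obtain ⟨k, -, hk⟩ := Finset.exists_ne_zero_of_sum_ne_zero hj.2
    simp only [Finset.mem_biUnion, Finset.mem_filter, Finset.mem_univ, true_and]
    exact ⟨k, left_ne_zero_of_mul hk, right_ne_zero_of_mul hk⟩
  refine (Finset.card_le_card hsub).trans ((Finset.card_biUnion_le_card_mul _ _ (nnzRow B)
    fun k _ => ?_).trans (Nat.mul_le_mul_right _ ?_))
  · exact nnzRow_le_iff.1 le_rfl k
  · exact nnzRow_le_iff.1 le_rfl i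

theorem nnzCol_mul_le (A B : Matrix m m F) : nnzCol (A * B) ≤ nnzCol A * nnzCol B := by
  rw [← nnzRow_transpose, Matrix.transpose_mul, mul_comm, ← nnzRow_transpose, ← nnzRow_transpose]
  exact nnzRow_mul_le _ _

theorem nnz_le_card_mul_nnzRow (S : Matrix m m F) : nnz S ≤ Fintype.card m * nnzRow S := by
  classical
  have hsub : (Finset.univ.filter fun p : m × m => S p.1 p.2 ≠ 0) ⊆
      (Finset.univ : Finset m).biUnion
        fun i => (Finset.univ.filter fun j => S i j ≠ 0).image (Prod.mk i) := by
    rintro ⟨i, j⟩ hij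
    simpa using hij
  rw [nnz, ← Finset.card_univ]
  convert (Finset.card_le_card hsub).trans (Finset.card_biUnion_le_card_mul _ _ (nnzRow S)
    fun i _ => Finset.card_image_le.trans (nnzRow_le_iff.1 le_rfl i))

/-- `A` is the sum of a matrix of rank at most `r` and a matrix with at most `s` nonzero entries in
every row and column. -/
def IsLowRankAddSparse (A : Matrix m m F) (r : ℝ) (s : ℝ) : Prop :=
  ∃ P S : Matrix m m F, A = P + S ∧ (P.rank : ℝ) ≤ r ∧ (nnzRow S : ℝ) ≤ s ∧ (nnzCol S : ℝ) ≤ s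

namespace IsLowRankAddSparse

variable {A B : Matrix m m F} {r r' s s' : ℝ}

theorem transpose (h : IsLowRankAddSparse A r s) : IsLowRankAddSparse A.transpose r s := by
  obtain ⟨P, S, rfl, hP, hS, hS'⟩ := h
  exact ⟨P.transpose, S.transpose, Matrix.transpose_add _ _, by rwa [Matrix.rank_transpose],
    by rwa [nnzRow_transpose], by rwa [nnzCol_transpose]⟩

/-- In `(P + S) * (P' + T)` every term except `S * T` contains `P` or `P'`; grouping them as `P *
(P' + T) + S * P'` makes the ranks add. -/
theorem mul (hA : IsLowRankAddSparse A r s) (hB : IsLowRankAddSparse B r' s') :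
    IsLowRankAddSparse (A * B) (r + r') (s * s') := by
  obtain ⟨P, S, rfl, hP, hS, hS'⟩ := hA
  obtain ⟨P', T, rfl, hP', hT, hT'⟩ := hB
  have hs : 0 ≤ s := (Nat.cast_nonneg _).trans hS
  refine ⟨P * (P' + T) + S * P', S * T, by noncomm_ring, ?_, ?_, ?_⟩
  · have h1 := rank_add_le (P * (P' + T)) (S * P')
    have h2 := Matrix.rank_mul_le_left P (P' + T)
    have h3 := Matrix.rank_mul_le_right S P'
    have h4 : ((P * (P' + T) + S * P').rank : ℝ) ≤ P.rank + P'.rank := by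
      exact_mod_cast h1.trans (add_le_add h2 h3)
    linarith
  · calc (nnzRow (S * T) : ℝ) ≤ nnzRow S * nnzRow T := by exact_mod_cast nnzRow_mul_le S T
      _ ≤ s * s' := by gcongr
  · calc (nnzCol (S * T) : ℝ) ≤ nnzCol S * nnzCol T := by exact_mod_cast nnzCol_mul_le S T
      _ ≤ s * s' := by gcongr

theorem rcRigidity_le (h : IsLowRankAddSparse A r s) : (rcRigidity A ⌊r⌋₊ : ℝ) ≤ s := by
  obtain ⟨P, S, rfl, hP, hS, hS'⟩ := h
  have h1 : rcRigidity (P + S) ⌊r⌋₊ ≤ max (nnzRow (-S)) (nnzCol (-S)) :=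
    Nat.sInf_le ⟨-S, by simpa using Nat.le_floor hP, rfl⟩
  have h2 : nnzRow (-S) = nnzRow S := nnzRow_neg S
  have h3 : nnzCol (-S) = nnzCol S := nnzCol_neg S
  rw [h2, h3] at h1
  refine (Nat.cast_le.2 h1).trans ?_
  rw [Nat.cast_max]
  exact max_le hS hS'

theorem rigidity_le (h : IsLowRankAddSparse A r s) :
    (rigidity A ⌊r⌋₊ : ℝ) ≤ Fintype.card m * s := by
  obtain ⟨P, S, rfl, hP, hS, hS'⟩ := h
  have h1 : rigidity (P + S) ⌊r⌋₊ ≤ nnz (-S) :=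
    Nat.sInf_le ⟨-S, by simpa using Nat.le_floor hP, rfl⟩
  have h2 : nnz (-S) = nnz S := nnz_neg S
  rw [h2] at h1
  calc (rigidity (P + S) ⌊r⌋₊ : ℝ) ≤ Fintype.card m * nnzRow S := by
        exact_mod_cast h1.trans (nnz_le_card_mul_nnzRow S)
    _ ≤ _ := by gcongr

theorem mono (h : IsLowRankAddSparse A r s) (hr : r ≤ r') (hs : s ≤ s') :
    IsLowRankAddSparse A r' s' := by
  obtain ⟨P, S, hA, hP, hS, hS'⟩ := h
  exact ⟨P, S, hA, hP.trans hr, hS.trans hs, hS'.trans hs⟩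

end IsLowRankAddSparse

open Classical in
/-- Clearing the rows in `X` and the columns in `Y` changes the rank by at most `|X| + |Y|`. -/
theorem isLowRankAddSparse_of_clear (A : Matrix m m F) (X Y : Finset m) {s : ℝ}
    (hrow : ∀ i ∉ X, ((Finset.univ.filter fun j => j ∉ Y ∧ A i j ≠ 0).card : ℝ) ≤ s)
    (hcol : ∀ j ∉ Y, ((Finset.univ.filter fun i => i ∉ X ∧ A i j ≠ 0).card : ℝ) ≤ s)
    (hs : 0 ≤ s) :
    IsLowRankAddSparse A (X.card + Y.card) s := by
  have hdiag : ∀ Z : Finset m,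
      (Matrix.diagonal fun i => if i ∈ Z then (1 : F) else 0).rank = Z.card := fun Z => by
    rw [Matrix.rank_diagonal]
    simp
  refine ⟨(Matrix.diagonal fun i => if i ∈ X then (1 : F) else 0) * A +
      (Matrix.of fun i j => if i ∈ X then 0 else A i j) *
        Matrix.diagonal fun j => if j ∈ Y then (1 : F) else 0,
      Matrix.of fun i j => if i ∈ X ∨ j ∈ Y then 0 else A i j, ?_, ?_, ?_, ?_⟩
  · ext i j
    by_cases hi : i ∈ X <;> by_cases hj : j ∈ Y <;>
      simp [Matrix.diagonal_mul, Matrix.mul_diagonal, hi, hj]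
  · have h := (rank_add_le _ _).trans (add_le_add
      (Matrix.rank_mul_le_left (Matrix.diagonal fun i => if i ∈ X then (1 : F) else 0) A)
      (Matrix.rank_mul_le_right (Matrix.of fun i j => if i ∈ X then 0 else A i j)
        (Matrix.diagonal fun j => if j ∈ Y then (1 : F) else 0)))
    rw [hdiag, hdiag] at h
    exact_mod_cast h
  · rw [← Nat.le_floor_iff hs, nnzRow_le_iff]
    intro i
    rw [Nat.le_floor_iff hs]
    by_cases hi : i ∈ X
    · simpa [hi] using hs
    · simpa [hi] using hrow i hi
  · rw [← Nat.le_floor_iff hs, nnzCol_le_iff]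
    intro j
    rw [Nat.le_floor_iff hs]
    by_cases hj : j ∈ Y
    · simpa [hj] using hs
    · simpa [hj] using hcol j hj

end LowRankAddSparse

/-! ### Kronecker products -/

section Kron

variable {F : Type*} [Field F] {n q : ℕ}

theorem kron_mul (A B : Fin n → Matrix (Fin q) (Fin q) F) :
    kron (fun l => A l * B l) = kron A * kron B := by
  ext x y
  simp only [kron, Matrix.of_apply, Matrix.mul_apply]
  rw [Finset.prod_univ_sum, Fintype.piFinset_univ]
  exact Finset.sum_congr rfl fun z _ => Finset.prod_mul_distrib

theorem kron_transpose (A : Fin n → Matrix (Fin q) (Fin q) F) :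
    kron (fun l => (A l).transpose) = (kron A).transpose := rfl

theorem isLowRankAddSparse_kron_of_triangular (hq : 0 < q) {η : ℝ} (hη : 0 < η) (hη' : η ≤ 1 / 2)
    (σ : Fin n → Equiv.Perm (Fin q)) (L : Fin n → Matrix (Fin q) (Fin q) F)
    (hL : ∀ l i k, L l i k ≠ 0 → k ≤ σ l i) :
    IsLowRankAddSparse (kron L)
      (2 * ((q : ℝ) ^ n * Real.exp (-(η ^ 2 * n / (2 * (q : ℝ) ^ 2)))))
      (Real.exp (n * (η * Real.log (1 / η) + 2 * η))) := by
  classical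
  have : NeZero q := ⟨hq.ne'⟩
  set μ : ℝ := n * (((q : ℝ) - 1) / 2) with hμ
  set X := Finset.univ.filter fun x : Fin n → Fin q =>
    μ + η * n / 2 < weight fun l => σ l (x l) with hX
  -- Reversing coordinates turns "too light" into "too heavy", so the same upper tail bound serves
  -- for columns.
  set Y := Finset.univ.filter fun y : Fin n → Fin q =>
    μ + η * n / 2 < weight fun l => Fin.revPerm (y l) with hY
  have hXc := card_weight_gt_le (n := n) hq σ hη.le
  have hYc := card_weight_gt_le (n := n) hq (fun _ => Fin.revPerm) hη.le
  rw [← hμ, ← hX] at hXc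
  rw [← hμ, ← hY] at hYc
  have hle : ∀ x y, kron L x y ≠ 0 → ∀ l, y l ≤ σ l (x l) := fun x y h l =>
    hL l _ _ (Finset.prod_ne_zero_iff.1 (by simpa only [kron, Matrix.of_apply] using h) l
      (Finset.mem_univ l))
  have hkey : ∀ x ∉ X, ∀ y ∉ Y, kron L x y ≠ 0 →
      weight (fun l => σ l (x l) - y l) ≤ η * n := by
    intro x hx y hy h
    simp only [hX, hY, Finset.mem_filter, Finset.mem_univ, true_and, not_lt] at hx hy
    -- Subtraction in `Fin q` does not wrap around, since `y l ≤ σ l (x l)`.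
    have h1 : weight (fun l => σ l (x l) - y l) = weight (fun l => σ l (x l)) - weight y := by
      rw [weight, weight, weight, ← Finset.sum_sub_distrib]
      refine Finset.sum_congr rfl fun l _ => ?_
      rw [Fin.sub_val_of_le (hle x y h l), Nat.cast_sub (hle x y h l)]
    have h2 : weight (fun l => Fin.revPerm (y l)) = 2 * μ - weight y := by
      rw [weight, weight, hμ, ← mul_assoc, mul_comm (2 : ℝ), mul_assoc,
        mul_div_cancel₀ _ (two_ne_zero), eq_sub_iff_add_eq, ← Finset.sum_add_distrib]
      have : ∀ l, (((Fin.revPerm (y l) : Fin q) : ℕ) : ℝ) + (y l : ℕ) = q - 1 := fun l => by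
        rw [Fin.revPerm_apply, Fin.val_rev, Nat.cast_sub (by omega)]
        push_cast
        ring
      simp only [this, Finset.sum_const, Finset.card_univ, Fintype.card_fin, nsmul_eq_mul]
    rw [h2] at hy
    rw [h1]
    linarith
  refine IsLowRankAddSparse.mono (isLowRankAddSparse_of_clear (kron L) X Y
    (fun x hx => ?_) (fun y hy => ?_) (Real.exp_pos _).le) (by linarith) le_rfl
  -- For fixed `x`, the map `y ↦ σ x - y` embeds the surviving support of the row into the light
  -- tuples; likewise for columns.
  · refine le_trans (Nat.cast_le.2 (Finset.card_le_card_of_injOn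
      (fun y l => σ l (x l) - y l) (fun y h => ?_) (fun y _ y' _ h => ?_)))
      (card_weight_le_le hη hη')
    · simp only [Finset.coe_filter, Finset.mem_univ, true_and, Set.mem_ofPred_eq] at h ⊢
      exact hkey x hx y h.1 h.2
    · funext l
      exact sub_right_injective (congrFun h l)
  · refine le_trans (Nat.cast_le.2 (Finset.card_le_card_of_injOn
      (fun x l => σ l (x l) - y l) (fun x h => ?_) (fun x _ x' _ h => ?_)))
      (card_weight_le_le hη hη')
    · simp only [Finset.coe_filter, Finset.mem_univ, true_and, Set.mem_ofPred_eq] at h ⊢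
      exact hkey x h.1 y hy h.2
    · funext l
      exact (σ l).injective (sub_left_injective (congrFun h l))

/-- The transpose of `U l` is lower triangular, so the triangular case applies to both factors. -/
theorem isLowRankAddSparse_kron (hq : 0 < q) {η : ℝ} (hη : 0 < η) (hη' : η ≤ 1 / 2)
    (M : Fin n → Matrix (Fin q) (Fin q) F) :
    IsLowRankAddSparse (kron M)
      (4 * ((q : ℝ) ^ n * Real.exp (-(η ^ 2 * n / (2 * (q : ℝ) ^ 2)))))
      (Real.exp (2 * (n * (η * Real.log (1 / η) + 2 * η)))) := by
  choose σ L U hL hU hM using fun l => exists_perm_triangular_mul_triangular q (M l)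
  have h1 := isLowRankAddSparse_kron_of_triangular hq hη hη' σ L hL
  have h2 := (isLowRankAddSparse_kron_of_triangular hq hη hη' (fun _ => 1)
    (fun l => (U l).transpose) fun l i k h => hU l k i h).transpose
  rw [kron_transpose, Matrix.transpose_transpose] at h2
  have h3 := h1.mul h2
  rw [← kron_mul, ← funext hM, ← Real.exp_add] at h3
  exact h3.mono (le_of_eq (by ring)) (le_of_eq (by ring_nf))

end Kron

/-! ### Choice of parameters -/

theorem pow_five_le_two_pow (q : ℕ) : (q : ℝ) ^ 5 ≤ 1000 * 2 ^ q := by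
  have h := Real.pow_div_factorial_le_exp (q * Real.log 2)
    (mul_nonneg q.cast_nonneg (Real.log_nonneg one_le_two)) 5
  rw [Real.exp_nat_mul, Real.exp_log two_pos, mul_pow, div_le_iff₀ (by positivity)] at h
  have hl : (0.69 : ℝ) ^ 5 ≤ Real.log 2 ^ 5 := by
    gcongr
    linarith [Real.log_two_gt_d9]
  have h5 : ((Nat.factorial 5 : ℕ) : ℝ) = 120 := by norm_num [Nat.factorial]
  rw [h5] at h
  have h0 : (0 : ℝ) < 2 ^ q := by positivity
  nlinarith [mul_le_mul_of_nonneg_left hl (by positivity : (0 : ℝ) ≤ (q : ℝ) ^ 5)]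

theorem log_le_natCast (q : ℕ) : Real.log q ≤ q := Real.log_le_self q.cast_nonneg

theorem rcRigidity_kron_le {F : Type*} [Field F] {q n : ℕ} (hq : 2 ≤ q) {ε : ℝ} (hε : 0 < ε)
    (hε' : ε < Real.exp (-5))
    (hn : 3200 * ((q : ℝ) * Real.log (1 / ε) / ε) ^ 2 ≤ (n : ℝ))
    (M : Fin n → Matrix (Fin q) (Fin q) F) :
    (rcRigidity (kron M)
      ⌊((q : ℝ) ^ n) ^ (1 - 1 / 1600000 * ((2 : ℝ) ^ (-(q : ℝ)) * (q : ℝ) * Real.log (q : ℝ))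
        * (ε ^ 2 / Real.log (1 / ε) ^ 2))⌋₊ : ℝ) ≤ ((q : ℝ) ^ n) ^ ε := by
  set L := Real.log (1 / ε) with hLdef
  have hL : 5 < L := by
    rw [hLdef, one_div, Real.log_inv]
    have := Real.log_lt_log hε hε'
    rw [Real.log_exp] at this
    linarith
  have hq2 : (2 : ℝ) ≤ q := by exact_mod_cast hq
  have hq0 : (0 : ℝ) < q := by linarith
  have hlogq : 0.69 ≤ Real.log q := by
    have := Real.log_le_log two_pos hq2
    linarith [Real.log_two_gt_d9]
  have hpow (a : ℝ) : ((q : ℝ) ^ n) ^ a = Real.exp (n * Real.log q * a) := by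
    rw [Real.rpow_def_of_pos (by positivity), Real.log_pow]
  have hε1 : ε < 1 := hε'.trans (by rw [Real.exp_lt_one_iff]; norm_num)
  -- Dividing by `log (1 / ε)` cancels the logarithm in `η log (1 / η)`, leaving a small multiple of
  -- `ε`.
  set η := ε / (20 * L) with hη
  have hη0 : 0 < η := by positivity
  have hη1 : η ≤ 1 / 2 := by
    rw [hη, div_le_iff₀ (by positivity)]
    linarith
  have hlogη : Real.log (1 / η) ≤ 2 * L + 4 := by
    have e : 1 / η = 20 * L * (1 / ε) := by
      rw [hη]
      field_simp
    have h20 : Real.log 20 ≤ 4 := by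
      rw [Real.log_le_iff_le_exp (by norm_num)]
      have h4 : Real.exp 4 = Real.exp 1 ^ 4 := by
        rw [← Real.exp_nat_mul]
        norm_num
      have : (2.7 : ℝ) ^ 4 ≤ Real.exp 1 ^ 4 := by
        gcongr
        linarith [Real.exp_one_gt_d9]
      rw [h4]
      exact le_trans (by norm_num) this
    rw [e, Real.log_mul (by positivity) (by positivity), Real.log_mul (by norm_num) (by positivity),
      ← hLdef]
    linarith [Real.log_le_self (by linarith : 0 ≤ L)]
  refine ((isLowRankAddSparse_kron (by omega) hη0 hη1 M).mono ?_ ?_).rcRigidity_le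
  · have hw : 3200 ≤ n * ε ^ 2 / (q ^ 2 * L ^ 2) := by
      rw [le_div_iff₀ (by positivity)]
      calc 3200 * ((q : ℝ) ^ 2 * L ^ 2) = 3200 * ((q : ℝ) * L / ε) ^ 2 * ε ^ 2 := by field_simp
        _ ≤ _ := by gcongr
    set w := n * ε ^ 2 / (q ^ 2 * L ^ 2) with hwdef
    -- Hoeffding saves a multiple of `1 / q²` in the exponent, which dominates the required `2 ^
    -- (-q) q log² q`.
    have hc : (2 : ℝ) ^ (-(q : ℝ)) * q ^ 3 * Real.log q ^ 2 ≤ 1000 := by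
      have hl : Real.log q ^ 2 ≤ (q : ℝ) ^ 2 := by
        have := log_le_natCast q
        gcongr
      rw [Real.rpow_neg (by norm_num), Real.rpow_natCast]
      calc ((2 : ℝ) ^ q)⁻¹ * q ^ 3 * Real.log q ^ 2 ≤ ((2 : ℝ) ^ q)⁻¹ * q ^ 3 * (q : ℝ) ^ 2 := by
            gcongr
        _ = (q : ℝ) ^ 5 / 2 ^ q := by ring
        _ ≤ 1000 := by
            rw [div_le_iff₀ (by positivity)]
            exact pow_five_le_two_pow q
    have h4 : (4 : ℝ) ≤ Real.exp 2 := by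
      have h : Real.exp 2 = Real.exp 1 * Real.exp 1 := by
        rw [← Real.exp_add]
        norm_num
      nlinarith [Real.exp_one_gt_d9]
    have hqn : (q : ℝ) ^ n = Real.exp (n * Real.log q) := by
      rw [Real.exp_nat_mul, Real.exp_log hq0]
    rw [hpow, hqn, ← Real.exp_add]
    refine (mul_le_mul_of_nonneg_right h4 (Real.exp_pos _).le).trans ?_
    rw [← Real.exp_add, Real.exp_le_exp]
    have e1 : η ^ 2 * n / (2 * (q : ℝ) ^ 2) = w / 800 := by
      rw [hη, hwdef]
      field_simp
      ring
    have e2 : n * Real.log q * (1 - 1 / 1600000 * ((2 : ℝ) ^ (-(q : ℝ)) * q * Real.log q)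
        * (ε ^ 2 / L ^ 2)) = n * Real.log q -
          1 / 1600000 * ((2 : ℝ) ^ (-(q : ℝ)) * q ^ 3 * Real.log q ^ 2) * w := by
      rw [hwdef]
      field_simp
    rw [e1, e2]
    -- Half of `w / 800` is at least `2` and absorbs the factor `4 ≤ exp 2`; the other half is `1000
    -- w / 1600000`.
    nlinarith [mul_le_mul_of_nonneg_right hc (by linarith : 0 ≤ w)]
  · rw [hpow, Real.exp_le_exp]
    have h1 : η * Real.log (1 / η) + 2 * η ≤ ε * 0.17 := by
      calc η * Real.log (1 / η) + 2 * η ≤ η * (2 * L + 4) + 2 * η := by gcongr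
        _ = ε * ((2 * L + 6) / (20 * L)) := by
            rw [hη]
            ring
        _ ≤ ε * 0.17 := by
            gcongr
            rw [div_le_iff₀ (by positivity)]
            linarith
    calc 2 * (n * (η * Real.log (1 / η) + 2 * η)) ≤ 2 * (n * (ε * 0.17)) := by gcongr
      _ = n * 0.34 * ε := by ring
      _ ≤ n * Real.log q * ε := by
        gcongr
        linarith

theorem not_isValiantRigid_kron {F : Type*} [Field F] {q n : ℕ → ℕ} (hq : ∀ k, 2 ≤ q k)
    (hn : Tendsto n atTop atTop)
    (hqn : (fun k => (q k : ℝ)) =O[atTop] fun k => Real.log (n k : ℝ))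
    (M : ∀ k, Fin (n k) → Matrix (Fin (q k)) (Fin (q k)) F) :
    ¬ IsValiantRigid fun k => kron (M k) := by
  rintro ⟨ε, hε, C, hC, hfreq⟩
  obtain ⟨D, hD, hqD⟩ := hqn.exists_pos
  -- The parameter `η` is taken to be `δ ^ 2`, so that `δ log (1 / δ) ≤ 1` bounds `η log (1 / η)` by
  -- `2 δ`.
  set δ : ℝ := min (1 / 2) (ε / 16) with hδ
  have hδ0 : 0 < δ := lt_min (by norm_num) (by positivity)
  have hδ1 : δ ≤ 1 / 2 := min_le_left _ _
  have hδε : δ ≤ ε / 16 := min_le_right _ _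
  have hη0 : 0 < δ ^ 2 := by positivity
  have hη1 : δ ^ 2 ≤ 1 / 2 := by nlinarith
  have hη : 2 * (δ ^ 2 * Real.log (1 / δ ^ 2) + 2 * δ ^ 2) ≤ ε / 2 := by
    have h1 : Real.log (1 / δ ^ 2) = 2 * Real.log (1 / δ) := by
      rw [← one_div_pow, Real.log_pow]
      norm_num
    have h2 : δ * Real.log (1 / δ) ≤ 1 := by
      calc δ * Real.log (1 / δ) ≤ δ * (1 / δ) := by
            gcongr
            exact Real.log_le_self (by positivity)
        _ = 1 := by field_simp
    rw [h1]
    nlinarith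
  set a : ℝ := (δ ^ 2) ^ 2 / 2 with ha
  have ha0 : 0 < a := by positivity
  have hnR : Tendsto (fun k => (n k : ℝ)) atTop atTop := tendsto_natCast_atTop_atTop.comp hn
  have hlog (p : ℕ) {b : ℝ} (hb : 0 < b) :
      ∀ᶠ k in atTop, Real.log (n k) ^ p ≤ b * (n k : ℝ) := by
    filter_upwards [hnR.eventually ((Real.isLittleO_pow_log_id_atTop (n := p)).bound hb)] with k hk
    simp only [id, Real.norm_eq_abs, Nat.abs_cast] at hk
    exact (le_abs_self _).trans hk
  refine hfreq ?_
  filter_upwards [hlog 3 (by positivity : 0 < a / D ^ 2), hlog 1 (by positivity : 0 < C / 8),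
    hlog 1 (by positivity : 0 < 1 / D), hqD.bound, hnR.eventually_ge_atTop 3]
    with k h3 hC8 hD1 hqk hn3
  rw [pow_one] at hC8 hD1
  have hq2 : (2 : ℝ) ≤ q k := by exact_mod_cast hq k
  have hq0 : (0 : ℝ) < q k := by linarith
  have hn0 : (0 : ℝ) < n k := by linarith
  have hlogn : 0 < Real.log (n k) := Real.log_pos (by linarith)
  have hlogq : 0.69 ≤ Real.log (q k) := by
    have := Real.log_le_log two_pos hq2
    linarith [Real.log_two_gt_d9]
  rw [Real.norm_eq_abs, Real.norm_eq_abs, Nat.abs_cast, abs_of_pos hlogn] at hqk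
  have hqlen : (q k : ℝ) ≤ n k := by
    rw [div_mul_eq_mul_div, one_mul, le_div_iff₀ hD] at hD1
    linarith
  have hcard : (Fintype.card (Fin (n k) → Fin (q k)) : ℝ) = (q k : ℝ) ^ n k := by simp
  have hN0 : (0 : ℝ) < (q k : ℝ) ^ n k := by positivity
  have hlogN : Real.log ((q k : ℝ) ^ n k) = n k * Real.log (q k) := Real.log_pow _ _
  have hll0 : 0 < Real.log (Real.log ((q k : ℝ) ^ n k)) := by
    refine Real.log_pos ?_
    rw [hlogN]
    nlinarith
  have hll : Real.log (Real.log ((q k : ℝ) ^ n k)) ≤ 2 * Real.log (n k) := by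
    have : Real.log (Real.log ((q k : ℝ) ^ n k)) ≤ Real.log ((n k : ℝ) ^ 2) := by
      rw [hlogN, pow_two]
      refine Real.log_le_log (by positivity) ?_
      gcongr
      exact (log_le_natCast _).trans hqlen
    rwa [Real.log_pow (n k : ℝ) 2, Nat.cast_two] at this
  -- As `q = O(log n)`, the exponent is of order at least `n / log² n`, eventually above `log n`.
  -- The rank is then at most `4 N / n`, while `log log N ≤ 2 log n`.
  have hexp : Real.exp (-((δ ^ 2) ^ 2 * n k / (2 * (q k : ℝ) ^ 2))) ≤ 1 / n k := by
    rw [one_div, ← Real.exp_log (inv_pos.2 hn0), Real.exp_le_exp, Real.log_inv, neg_le_neg_iff,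
      le_div_iff₀ (by positivity)]
    calc Real.log (n k) * (2 * (q k : ℝ) ^ 2)
        ≤ Real.log (n k) * (2 * (D * Real.log (n k)) ^ 2) := by gcongr
      _ = 2 * D ^ 2 * Real.log (n k) ^ 3 := by ring
      _ ≤ 2 * D ^ 2 * (a / D ^ 2 * n k) := by gcongr
      _ = (δ ^ 2) ^ 2 * n k := by
          rw [ha]
          field_simp
  rw [hcard, not_le]
  refine lt_of_le_of_lt ((isLowRankAddSparse_kron (by linarith [hq k]) hη0 hη1 (M k)).mono ?_
    le_rfl).rigidity_le ?_
  · rw [le_div_iff₀ hll0]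
    calc 4 * ((q k : ℝ) ^ n k * Real.exp (-((δ ^ 2) ^ 2 * n k / (2 * (q k : ℝ) ^ 2)))) *
          Real.log (Real.log ((q k : ℝ) ^ n k))
        ≤ 4 * ((q k : ℝ) ^ n k * (1 / n k)) * (2 * Real.log (n k)) := by gcongr
      _ ≤ 4 * ((q k : ℝ) ^ n k * (1 / n k)) * (2 * (C / 8 * n k)) := by gcongr
      _ = C * (q k : ℝ) ^ n k := by
          field_simp
          norm_num
  · rw [hcard, Real.rpow_add hN0, Real.rpow_one]
    refine mul_lt_mul_of_pos_left ?_ hN0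
    rw [Real.rpow_def_of_pos hN0, hlogN, Real.exp_lt_exp]
    calc 2 * (n k * (δ ^ 2 * Real.log (1 / δ ^ 2) + 2 * δ ^ 2))
        = n k * (2 * (δ ^ 2 * Real.log (1 / δ ^ 2) + 2 * δ ^ 2)) := by ring
      _ ≤ n k * (ε / 2) := by gcongr
      _ < n k * (Real.log (q k) * ε) := by
          gcongr
          nlinarith
      _ = n k * Real.log (q k) * ε := by ring

end KroneckerRigidity

theorem theorem7p1 :
    -- the rigidity bound, with absolute constants `c`, `ε₀`, `K`
    (∃ c : ℝ, 0 < c ∧ ∃ ε₀ : ℝ, 0 < ε₀ ∧ ε₀ < 1 ∧ ∃ K : ℝ, 0 < K ∧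
      ∀ (F : Type*) [Field F] (q n : ℕ), 2 ≤ q →
      ∀ ε : ℝ, 0 < ε → ε < ε₀ → K * ((q : ℝ) * Real.log (1 / ε) / ε) ^ 2 ≤ (n : ℝ) →
      ∀ M : Fin n → Matrix (Fin q) (Fin q) F,
        (KroneckerRigidity.rcRigidity (KroneckerRigidity.kron M)
          ⌊((q : ℝ) ^ n) ^
            (1 - c * ((2 : ℝ) ^ (-(q : ℝ)) * (q : ℝ) * Real.log (q : ℝ))
              * (ε ^ 2 / Real.log (1 / ε) ^ 2))⌋₊ : ℝ)
          ≤ ((q : ℝ) ^ n) ^ ε) ∧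
    -- no family of such products with `q ≤ O(log n)` is Valiant-rigid
    (∀ (F : Type*) [Field F] (q n : ℕ → ℕ), (∀ k, 2 ≤ q k) → Tendsto n atTop atTop →
      ((fun k => (q k : ℝ)) =O[atTop] fun k => Real.log (n k : ℝ)) →
      ∀ M : ∀ k, Fin (n k) → Matrix (Fin (q k)) (Fin (q k)) F,
        ¬ KroneckerRigidity.IsValiantRigid fun k => KroneckerRigidity.kron (M k)) := by
  refine ⟨⟨1 / 1600000, by norm_num, Real.exp (-5), Real.exp_pos _,
    by rw [Real.exp_lt_one_iff]; norm_num, 3200, by norm_num, ?_⟩, ?_⟩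
  · intro F _ q n hq ε hε hε' hn M
    exact KroneckerRigidity.rcRigidity_kron_le hq hε hε' hn M
  · intro F _ q n hq hn hqn M
    exact KroneckerRigidity.not_isValiantRigid_kron hq hn hqn M
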